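/- Let $|B_1\rangle=\frac{1}{\sqrt2}(|00\rangle+|11\rangle)$, $|B_2\rangle=\frac{1}{\sqrt2}(|00\rangle-|11\rangle)$, $|B_3\rangle=\frac{1}{\sqrt2}(|01\rangle+|10\rangle)$, $|B_4\rangle=\frac{1}{\sqrt2}(|01\rangle-|10\rangle)$ be the four Bell states in $\mathbb{C}^2\otimes\mathbb{C}^2$; they are orthonormal. For $1\le j<k\le 4$ let $$\rho_{\{j,k\}}=\tfrac12\,|B_j\rangle\langle B_j|_{A_1B_1}\otimes|B_k\rangle\langle B_k|_{A_2B_2}+\tfrac12\,|B_k\rangle\langle B_k|_{A_1B_1}\otimes|B_j\rangle\langle B_j|_{A_2B_2}$$ be the state shared by Alice (who holds $A_1A_2$) and Bob (who holds $B_1B_2$) when the two distinct Bell states $|B_j\rangle,|B_k\rangle$ are distributed to them in unknown order. Then the set $\{|B_1\rangle,\dots,|B_4\rangle\}$ is $(4,2)$-unidentifiable: there is no measurement implementable by local operations and classical communication (LOCC) between Alice and Bob, with any number of rounds (including limits of protocols in which each one continues the preceding one by further rounds), which for each of the six two-element subsets $\{j,k\}\subset\{1,2,3,4\}$ returns $\{j,k\}$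 with probability one on the state $\rho_{\{j,k\}}$. -/

import Mathlib

open scoped Kronecker Matrix

noncomputable section

namespace LSI

/-- A bipartite LOCC protocol with finitely many rounds, started when Alice holds a system
`ℂ^a` and Bob holds a system `ℂ^b`, and ending with an answer in `O`.
In each round one party applies a local quantum instrument: outcome `x` is the completely
positive map `σ ↦ ∑ j, K x j * σ * (K x j)ᴴ` from its current system to a system of
dimension `d x`, and the sum over all outcomes is trace preserving.
The outcome `x` is announced, and the rest of the protocol may depend on it. -/
inductive Protocol (O : Type) : ℕ → ℕ → Type
  | halt {a b : ℕ} (answer : O) : Protocol O a b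
  | alice {a b : ℕ} (m : ℕ) (r d : Fin m → ℕ)
      (K : (x : Fin m) → Fin (r x) → Matrix (Fin (d x)) (Fin a) ℂ)
      (hK : ∑ x, ∑ j, (K x j)ᴴ * K x j = 1)
      (next : (x : Fin m) → Protocol O (d x) b) : Protocol O a b
  | bob {a b : ℕ} (m : ℕ) (r d : Fin m → ℕ)
      (K : (x : Fin m) → Fin (r x) → Matrix (Fin (d x)) (Fin b) ℂ)
      (hK : ∑ x, ∑ j, (K x j)ᴴ * K x j = 1)
      (next : (x : Fin m) → Protocol O a (d x)) : Protocol O a b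

/-- The POVM on `ℂ^a ⊗ ℂ^b` realised by a finite protocol: on the state `ρ`, the protocol
answers `o` with probability `trace (T.effect o * ρ)`. -/
def Protocol.effect {O : Type} [DecidableEq O] :
    {a b : ℕ} → Protocol O a b → O → Matrix (Fin a × Fin b) (Fin a × Fin b) ℂ
  | _, _, .halt answer, o => if answer = o then 1 else 0
  | _, b, .alice _ _ _ K _ next, o =>
      ∑ x, ∑ j, (K x j ⊗ₖ (1 : Matrix (Fin b) (Fin b) ℂ))ᴴ * (next x).effect o *
        (K x j ⊗ₖ (1 : Matrix (Fin b) (Fin b) ℂ))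
  | a, _, .bob _ _ _ K _ next, o =>
      ∑ x, ∑ j, ((1 : Matrix (Fin a) (Fin a) ℂ) ⊗ₖ K x j)ᴴ * (next x).effect o *
        ((1 : Matrix (Fin a) (Fin a) ℂ) ⊗ₖ K x j)

/-- `Extends T T'`: the protocol `T'` runs like `T`, except that where `T` stops, `T'` may
carry on with further rounds (and revise the answer). -/
inductive Extends {O : Type} : {a b : ℕ} → Protocol O a b → Protocol O a b → Prop
  | halt {a b : ℕ} (answer : O) (T : Protocol O a b) : Extends (.halt answer) T
  | alice {a b : ℕ} (m : ℕ) (r d : Fin m → ℕ)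
      (K : (x : Fin m) → Fin (r x) → Matrix (Fin (d x)) (Fin a) ℂ)
      (hK : ∑ x, ∑ j, (K x j)ᴴ * K x j = 1)
      (next next' : (x : Fin m) → Protocol O (d x) b)
      (h : ∀ x, Extends (next x) (next' x)) :
      Extends (.alice m r d K hK next) (.alice m r d K hK next')
  | bob {a b : ℕ} (m : ℕ) (r d : Fin m → ℕ)
      (K : (x : Fin m) → Fin (r x) → Matrix (Fin (d x)) (Fin b) ℂ)
      (hK : ∑ x, ∑ j, (K x j)ᴴ * K x j = 1)
      (next next' : (x : Fin m) → Protocol O a (d x))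
      (h : ∀ x, Extends (next x) (next' x)) :
      Extends (.bob m r d K hK next) (.bob m r d K hK next')

/-- `M` is a measurement that can be implemented by LOCC, with no bound on the number of rounds:
there are finite protocols, each one continuing the one before, whose POVMs converge to `M`.
A constant sequence gives the protocols with finitely many rounds. -/
def IsLOCC {O : Type} [DecidableEq O] {a b : ℕ}
    (M : O → Matrix (Fin a × Fin b) (Fin a × Fin b) ℂ) : Prop :=
  ∃ T : ℕ → Protocol O a b, (∀ i, Extends (T i) (T (i + 1))) ∧
    ∀ o, Filter.Tendsto (fun i => (T i).effect o) Filter.atTop (nhds (M o))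

/-- The product vector `ψ_{f 0} ⊗ ⋯ ⊗ ψ_{f (k-1)}`, where the `j`-th factor lives on
`A_j B_j`, regrouped as a vector of `(A_0 ⋯ A_{k-1}) ⊗ (B_0 ⋯ B_{k-1}) = ℂ^(dA^k) ⊗ ℂ^(dB^k)`. -/
def orderedState {n dA dB : ℕ} (ψ : Fin n → EuclideanSpace ℂ (Fin dA × Fin dB)) {k : ℕ}
    (f : Fin k → Fin n) : Fin (dA ^ k) × Fin (dB ^ k) → ℂ :=
  fun p => ∏ j, ψ (f j) (finFunctionFinEquiv.symm p.1 j, finFunctionFinEquiv.symm p.2 j)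

/-- The state shared when the `k` elements of the subset `{ψ_i | i ∈ s}` are distributed in
unknown order: the equal mixture of the `k!` orderings. -/
def subsetState {n dA dB : ℕ} (ψ : Fin n → EuclideanSpace ℂ (Fin dA × Fin dB)) (k : ℕ)
    (s : Finset (Fin n)) :
    Matrix (Fin (dA ^ k) × Fin (dB ^ k)) (Fin (dA ^ k) × Fin (dB ^ k)) ℂ :=
  ((k.factorial : ℂ)⁻¹) • ∑ e : Fin k ≃ s,
    Matrix.vecMulVec (orderedState ψ fun j => (e j : Fin n))
      (star (orderedState ψ fun j => (e j : Fin n)))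

/-- The set `{ψ_0, …, ψ_{n-1}}` is `(n,k)`-identifiable: some LOCC measurement, whose outcomes
are subsets, returns with probability one the subset that was distributed, whichever of the
`k`-element subsets this is. -/
def IsIdentifiable {n dA dB : ℕ} (ψ : Fin n → EuclideanSpace ℂ (Fin dA × Fin dB)) (k : ℕ) :
    Prop :=
  ∃ M : Finset (Fin n) →
      Matrix (Fin (dA ^ k) × Fin (dB ^ k)) (Fin (dA ^ k) × Fin (dB ^ k)) ℂ,
    IsLOCC M ∧ ∀ s : Finset (Fin n), s.card = k → (M s * subsetState ψ k s).trace = 1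

/-- The computational basis vector `|p q⟩` of two qubits. -/
def ket (p q : Fin 2) : EuclideanSpace ℂ (Fin 2 × Fin 2) := EuclideanSpace.single (p, q) 1

/-- The four Bell states. -/
def bell : Fin 4 → EuclideanSpace ℂ (Fin 2 × Fin 2) :=
  ![((√2 : ℝ) : ℂ)⁻¹ • (ket 0 0 + ket 1 1), ((√2 : ℝ) : ℂ)⁻¹ • (ket 0 0 - ket 1 1),
    ((√2 : ℝ) : ℂ)⁻¹ • (ket 0 1 + ket 1 0), ((√2 : ℝ) : ℂ)⁻¹ • (ket 0 1 - ket 1 0)]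

end LSI

end

/-!
If the reduced state `ρ_A` of a bipartite state `ρ` on Alice's side is known, the reduction
criterion bounds the probability of any product effect, `tr ((A ⊗ B) ρ) ≤ tr ((A ⊗ B) (ρ_A ⊗ 1))`,
because `B ≤ (tr B) 1`. The inequality passes to sums of product effects, hence to finite
protocols, and to their limits. When `ρ_A` is maximally mixed on a space of dimension `d`, the
right-hand side is `d⁻¹ tr E` for the effect `E`. The `k`-element subsets of a family of maximally
entangled states have such a `ρ_A` with `d = dA ^ k`, and the effects of a measurement add up to the
identity, of trace `dA ^ k * dB ^ k`, so the success probabilities add up to at most `dB ^ k`.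
For the Bell states there are six subsets, but `dB ^ k = 4`.
-/

open scoped ComplexOrder MatrixOrder

namespace LSI

section Trace

variable {n 𝕜 : Type*} [Fintype n] [RCLike 𝕜]

theorem trace_mul_cycle_four {m p q R : Type*} [Fintype m] [Fintype p] [Fintype q]
    [CommSemiring R] (A : Matrix n m R) (B : Matrix m p R) (C : Matrix p q R) (D : Matrix q n R) :
    (A * B * C * D).trace = (B * (C * D * A)).trace := by
  rw [Matrix.mul_assoc, Matrix.mul_assoc, Matrix.trace_mul_comm, Matrix.mul_assoc]

theorem trace_mul_nonneg {A B : Matrix n n 𝕜} (hA : A.PosSemidef) (hB : B.PosSemidef) :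
    0 ≤ (A * B).trace := by
  classical
  obtain ⟨X, rfl⟩ := CStarAlgebra.nonneg_iff_eq_star_mul_self.mp hA.nonneg
  rw [Matrix.star_eq_conjTranspose, Matrix.mul_assoc, Matrix.trace_mul_comm]
  exact (hB.mul_mul_conjTranspose_same X).trace_nonneg

theorem posSemidef_trace_smul_one_sub [DecidableEq n] {B : Matrix n n 𝕜} (hB : B.PosSemidef) :
    (B.trace • (1 : Matrix n n 𝕜) - B).PosSemidef := by
  have eigenvalue_le (i : n) : hB.1.eigenvalues i ≤ ∑ j, hB.1.eigenvalues j :=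
    Finset.single_le_sum (fun j _ => hB.eigenvalues_nonneg j) (Finset.mem_univ i)
  have le_trace : B ≤ algebraMap ℝ _ (∑ j, hB.1.eigenvalues j) := by
    rw [le_algebraMap_iff_spectrum_le, hB.1.spectrum_real_eq_range_eigenvalues]
    rintro _ ⟨i, rfl⟩
    exact eigenvalue_le i
  rw [hB.1.trace_eq_sum_eigenvalues]
  convert Matrix.le_iff.mp le_trace using 2
  ext i j
  simp [Matrix.algebraMap_matrix_apply, Matrix.one_apply]

end Trace

section PartialTrace

variable {m n R : Type*} [Fintype n] [CommSemiring R]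

/-- The partial trace over the second factor, which sends the state of a bipartite system to the
reduced state of its first half. -/
def partialTrace : Matrix (m × n) (m × n) R →ₗ[R] Matrix m m R where
  toFun ρ := .of fun i i' => ∑ j, ρ (i, j) (i', j)
  map_add' ρ σ := by ext; simp [Finset.sum_add_distrib]
  map_smul' c ρ := by ext; simp [Finset.mul_sum]

theorem partialTrace_apply (ρ : Matrix (m × n) (m × n) R) (i i' : m) :
    partialTrace ρ i i' = ∑ j, ρ (i, j) (i', j) :=
  rfl

theorem trace_kronecker_one_mul [Fintype m] [DecidableEq n] (A : Matrix m m R)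
    (ρ : Matrix (m × n) (m × n) R) :
    ((A ⊗ₖ (1 : Matrix n n R)) * ρ).trace = (A * partialTrace ρ).trace := by
  simp only [Matrix.trace, Matrix.diag_apply, Matrix.mul_apply, Fintype.sum_prod_type,
    Matrix.kronecker_apply, Matrix.one_apply, partialTrace_apply, mul_ite, mul_one, mul_zero,
    ite_mul, zero_mul, Finset.sum_ite_eq, Finset.mem_univ, if_true, Finset.mul_sum]
  exact Finset.sum_congr rfl fun _ _ => Finset.sum_comm

end PartialTrace

section BlockPositive

variable {m n m' n' 𝕜 : Type*} [Fintype m] [Fintype n] [Fintype m'] [Fintype n'] [RCLike 𝕜]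

/-- Block positivity: nonnegative expectation on all product effects. Such operators form the dual
of the cone of separable operators; those that are not positive semidefinite are the entanglement
witnesses. -/
def IsBlockPositive (W : Matrix (m × n) (m × n) 𝕜) : Prop :=
  ∀ ⦃A : Matrix m m 𝕜⦄ ⦃B : Matrix n n 𝕜⦄, A.PosSemidef → B.PosSemidef → 0 ≤ (A ⊗ₖ B * W).trace

theorem isBlockPositive_of_posSemidef {W : Matrix (m × n) (m × n) 𝕜} (hW : W.PosSemidef) :
    IsBlockPositive W :=
  fun _ _ hA hB => trace_mul_nonneg (hA.kronecker hB) hW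

theorem IsBlockPositive.mul_mul_conjTranspose {W : Matrix (m × n) (m × n) 𝕜}
    (hW : IsBlockPositive W) (K : Matrix m' m 𝕜) (L : Matrix n' n 𝕜) :
    IsBlockPositive (K ⊗ₖ L * W * (K ⊗ₖ L)ᴴ) := by
  intro A B hA hB
  rw [← trace_mul_cycle_four, Matrix.conjTranspose_kronecker,
    ← Matrix.mul_kronecker_mul, ← Matrix.mul_kronecker_mul]
  exact hW (hA.conjTranspose_mul_mul_same K) (hB.conjTranspose_mul_mul_same L)

theorem isBlockPositive_partialTrace_kronecker_one_sub [DecidableEq n]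
    {ρ : Matrix (m × n) (m × n) 𝕜} (hρ : ρ.PosSemidef) :
    IsBlockPositive (partialTrace ρ ⊗ₖ (1 : Matrix n n 𝕜) - ρ) := by
  intro A B hA hB
  have reduced : (A ⊗ₖ B * partialTrace ρ ⊗ₖ (1 : Matrix n n 𝕜)).trace =
      (A ⊗ₖ (B.trace • (1 : Matrix n n 𝕜)) * ρ).trace := by
    rw [← Matrix.mul_kronecker_mul, Matrix.mul_one, Matrix.trace_kronecker, Matrix.kronecker_smul,
      Matrix.smul_mul, Matrix.trace_smul, trace_kronecker_one_mul, smul_eq_mul, mul_comm]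
  have kronecker_sub : A ⊗ₖ (B.trace • (1 : Matrix n n 𝕜)) - A ⊗ₖ B =
      A ⊗ₖ (B.trace • (1 : Matrix n n 𝕜) - B) := by
    ext
    simp [mul_sub]
  rw [Matrix.mul_sub, Matrix.trace_sub, reduced, ← Matrix.trace_sub, ← Matrix.sub_mul,
    kronecker_sub]
  exact trace_mul_nonneg (hA.kronecker (posSemidef_trace_smul_one_sub hB)) hρ

end BlockPositive

section LOCC

variable {O : Type} [DecidableEq O] {a b : ℕ}

theorem Protocol.trace_effect_mul_nonneg (T : Protocol O a b) (o : O)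
    {W : Matrix (Fin a × Fin b) (Fin a × Fin b) ℂ} (hW : IsBlockPositive W) :
    0 ≤ (T.effect o * W).trace := by
  induction T with
  | halt answer =>
    rw [Protocol.effect]
    split_ifs
    · simpa only [Matrix.one_kronecker_one] using hW .one .one
    · simp
  | alice _ _ _ K _ _ ih | bob _ _ _ K _ _ ih =>
    simp only [Protocol.effect, Matrix.sum_mul, Matrix.trace_sum, trace_mul_cycle_four]
    exact Finset.sum_nonneg fun x _ => Finset.sum_nonneg fun j _ =>
      ih x (hW.mul_mul_conjTranspose _ _)

theorem Protocol.sum_effect [Fintype O] (T : Protocol O a b) : ∑ o, T.effect o = 1 := by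
  induction T with
  | halt answer => simp [Protocol.effect]
  | alice _ _ _ K hK _ ih | bob _ _ _ K hK _ ih =>
    simp only [Protocol.effect]
    rw [Finset.sum_comm]
    simp_rw [Finset.sum_comm (s := (Finset.univ : Finset O)), ← Matrix.sum_mul, ← Matrix.mul_sum,
      ih, Matrix.mul_one, Matrix.conjTranspose_kronecker, ← Matrix.mul_kronecker_mul]
    rw [← Matrix.one_kronecker_one, ← hK]
    ext ⟨i, i'⟩ ⟨j, j'⟩
    simp [Matrix.sum_apply, Finset.sum_mul, Finset.mul_sum]

variable {M : O → Matrix (Fin a × Fin b) (Fin a × Fin b) ℂ}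

theorem IsLOCC.trace_mul_nonneg (hM : IsLOCC M) (o : O)
    {W : Matrix (Fin a × Fin b) (Fin a × Fin b) ℂ} (hW : IsBlockPositive W) :
    0 ≤ (M o * W).trace := by
  obtain ⟨T, -, hT⟩ := hM
  have trace_continuous : Continuous fun E : Matrix (Fin a × Fin b) (Fin a × Fin b) ℂ =>
      (E * W).trace := by fun_prop
  exact ge_of_tendsto' ((trace_continuous.tendsto _).comp (hT o)) fun i =>
    (T i).trace_effect_mul_nonneg o hW

theorem IsLOCC.trace_nonneg (hM : IsLOCC M) (o : O) : 0 ≤ (M o).trace := by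
  simpa only [Matrix.mul_one] using hM.trace_mul_nonneg o (isBlockPositive_of_posSemidef .one)

theorem IsLOCC.trace_mul_le (hM : IsLOCC M) (o : O) {c : ℂ}
    {ρ : Matrix (Fin a × Fin b) (Fin a × Fin b) ℂ} (hρ : ρ.PosSemidef)
    (hc : partialTrace ρ = c • 1) : (M o * ρ).trace ≤ c * (M o).trace := by
  have h := hM.trace_mul_nonneg o (isBlockPositive_partialTrace_kronecker_one_sub hρ)
  rwa [hc, Matrix.smul_kronecker, Matrix.one_kronecker_one, Matrix.mul_sub, Matrix.mul_smul,
    Matrix.mul_one, Matrix.trace_sub, Matrix.trace_smul, smul_eq_mul, sub_nonneg] at h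

theorem IsLOCC.sum_eq_one [Fintype O] (hM : IsLOCC M) : ∑ o, M o = 1 := by
  obtain ⟨T, -, hT⟩ := hM
  refine tendsto_nhds_unique (tendsto_finsetSum Finset.univ fun o _ => hT o) ?_
  simp only [Protocol.sum_effect]
  exact tendsto_const_nhds

end LOCC

/-- Maximal entanglement of the vector `v`: the reduced state of its first half is maximally mixed,
which includes the normalisation of `v`. The factors need not have equal dimension. -/
def IsMaximallyEntangled {m n : Type*} [Fintype m] [Fintype n] [DecidableEq m]
    (v : m × n → ℂ) : Prop :=
  partialTrace (Matrix.vecMulVec v (star v)) = (Fintype.card m : ℂ)⁻¹ • 1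

section SubsetState

variable {n dA dB : ℕ} {ψ : Fin n → EuclideanSpace ℂ (Fin dA × Fin dB)} {k : ℕ}

theorem partialTrace_vecMulVec_orderedState (ψ : Fin n → EuclideanSpace ℂ (Fin dA × Fin dB))
    (f : Fin k → Fin n) (p p' : Fin (dA ^ k)) :
    partialTrace (Matrix.vecMulVec (orderedState ψ f) (star (orderedState ψ f))) p p' =
      ∏ j, partialTrace (Matrix.vecMulVec (ψ (f j)) (star (ψ (f j))))
        (finFunctionFinEquiv.symm p j) (finFunctionFinEquiv.symm p' j) := by
  simp only [partialTrace_apply, Matrix.vecMulVec_apply, Pi.star_apply, Fintype.prod_sum]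
  rw [← finFunctionFinEquiv.sum_comp]
  simp only [orderedState, star_prod, ← Finset.prod_mul_distrib, Equiv.symm_apply_apply]

theorem isMaximallyEntangled_orderedState (hψ : ∀ i, IsMaximallyEntangled (ψ i))
    (f : Fin k → Fin n) : IsMaximallyEntangled (orderedState ψ f) := by
  ext p p'
  rw [partialTrace_vecMulVec_orderedState]
  have digits_eq :
      (∀ j, finFunctionFinEquiv.symm p j = finFunctionFinEquiv.symm p' j) ↔ p = p' := by
    rw [← funext_iff, EmbeddingLike.apply_eq_iff_eq]
  simp only [IsMaximallyEntangled] at hψ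
  simp only [hψ, Matrix.smul_apply, Matrix.one_apply,
    Fintype.card_fin, smul_eq_mul, Finset.prod_mul_distrib, Finset.prod_const, Finset.card_univ,
    Nat.cast_pow, inv_pow, Finset.prod_boole, Finset.mem_univ, true_imp_iff, digits_eq]

theorem posSemidef_subsetState (ψ : Fin n → EuclideanSpace ℂ (Fin dA × Fin dB)) (k : ℕ)
    (s : Finset (Fin n)) : (subsetState ψ k s).PosSemidef :=
  (Matrix.posSemidef_sum _ fun _ _ => Matrix.posSemidef_vecMulVec_self_star _).smul
    (by positivity)

theorem partialTrace_subsetState (hψ : ∀ i, IsMaximallyEntangled (ψ i)) {s : Finset (Fin n)}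
    (hs : s.card = k) : partialTrace (subsetState ψ k s) = ((dA : ℂ) ^ k)⁻¹ • 1 := by
  have card_orderings : Fintype.card (Fin k ≃ s) = k.factorial := by
    rw [Fintype.card_equiv (Fintype.equivOfCardEq (by simp [hs])), Fintype.card_fin]
  have reduced (e : Fin k ≃ s) := isMaximallyEntangled_orderedState hψ fun j => (e j : Fin n)
  simp only [IsMaximallyEntangled, Fintype.card_fin, Nat.cast_pow] at reduced
  rw [subsetState, map_smul, map_sum, Finset.sum_congr rfl fun e _ => reduced e, Finset.sum_const,
    Finset.card_univ, card_orderings, ← Nat.cast_smul_eq_nsmul ℂ,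
    inv_smul_smul₀ (Nat.cast_ne_zero.mpr k.factorial_ne_zero)]

theorem IsLOCC.sum_trace_mul_subsetState_le (hψ : ∀ i, IsMaximallyEntangled (ψ i))
    {M : Finset (Fin n) → Matrix (Fin (dA ^ k) × Fin (dB ^ k)) (Fin (dA ^ k) × Fin (dB ^ k)) ℂ}
    (hM : IsLOCC M) :
    ∑ s ∈ Finset.univ.powersetCard k, (M s * subsetState ψ k s).trace ≤ (dB : ℂ) ^ k := by
  have inv_nonneg : 0 ≤ ((dA : ℂ) ^ k)⁻¹ := by positivity
  calc ∑ s ∈ Finset.univ.powersetCard k, (M s * subsetState ψ k s).trace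
    _ ≤ ∑ s ∈ Finset.univ.powersetCard k, ((dA : ℂ) ^ k)⁻¹ * (M s).trace :=
      Finset.sum_le_sum fun s hs => hM.trace_mul_le s (posSemidef_subsetState ψ k s)
        (partialTrace_subsetState hψ (Finset.mem_powersetCard.mp hs).2)
    _ ≤ ∑ s, ((dA : ℂ) ^ k)⁻¹ * (M s).trace :=
      Finset.sum_le_sum_of_subset_of_nonneg (Finset.subset_univ _) fun s _ _ =>
        mul_nonneg inv_nonneg (hM.trace_nonneg s)
    _ = ((dA : ℂ) ^ k)⁻¹ * (dA ^ k * dB ^ k) := by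
      rw [← Finset.mul_sum, ← Matrix.trace_sum, hM.sum_eq_one, Matrix.trace_one]
      simp
    _ ≤ (dB : ℂ) ^ k := by
      rcases eq_or_ne ((dA : ℂ) ^ k) 0 with hd | hd
      · simp only [hd, inv_zero, zero_mul]
        positivity
      · rw [inv_mul_cancel_left₀ hd]

end SubsetState

theorem inv_sqrt_two_mul_self : ((√2 : ℝ) : ℂ)⁻¹ * ((√2 : ℝ) : ℂ)⁻¹ = 2⁻¹ := by
  rw [← mul_inv, ← Complex.ofReal_mul, Real.mul_self_sqrt (by norm_num), Complex.ofReal_ofNat]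

theorem isMaximallyEntangled_bell (i : Fin 4) : IsMaximallyEntangled (bell i) := by
  ext p p'
  fin_cases i <;> fin_cases p <;> fin_cases p' <;>
    simp [partialTrace_apply, Matrix.vecMulVec_apply, bell, ket, inv_sqrt_two_mul_self]

theorem orthonormal_bell : Orthonormal ℂ bell := by
  rw [orthonormal_iff_ite]
  intro i j
  rw [PiLp.inner_apply, Fintype.sum_prod_type]
  fin_cases i <;> fin_cases j <;>
    norm_num [bell, ket, Fin.sum_univ_two, ← Complex.ofReal_pow, sq_abs]

end LSI

theorem mainTheorem1_general {n dA dB k : ℕ} {ψ : Fin n → EuclideanSpace ℂ (Fin dA × Fin dB)}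
    (hψ : ∀ i, LSI.IsMaximallyEntangled (ψ i)) (hnk : dB ^ k < n.choose k) :
    ¬ LSI.IsIdentifiable ψ k := by
  rintro ⟨M, hM, identifies⟩
  have choose_le : (n.choose k : ℂ) ≤ (dB : ℂ) ^ k := by
    calc (n.choose k : ℂ) = ∑ s ∈ (Finset.univ : Finset (Fin n)).powersetCard k, 1 := by simp
      _ = ∑ s ∈ Finset.univ.powersetCard k, (M s * LSI.subsetState ψ k s).trace :=
        Finset.sum_congr rfl fun s hs => (identifies s (Finset.mem_powersetCard.mp hs).2).symm
      _ ≤ (dB : ℂ) ^ k := hM.sum_trace_mul_subsetState_le hψ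
  exact hnk.not_ge (by exact_mod_cast choose_le)

/-- The four Bell states are orthonormal, and they are not `(4,2)`-identifiable by LOCC. -/
theorem mainTheorem1 : Orthonormal ℂ LSI.bell ∧ ¬ LSI.IsIdentifiable LSI.bell 2 :=
  ⟨LSI.orthonormal_bell, mainTheorem1_general LSI.isMaximallyEntangled_bell (by decide)⟩
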